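/- Let $G$ be a ring (associative, not necessarily commutative or unital), let $(X,\rho)$ be a nonempty precompact (i.e. totally bounded) metric space, for instance a nonempty compact one, and let $T_1,\dots,T_t$ be pairwise commuting actions of the additive group of $G$ on $X$ by self-mappings: for each $l$, $T_l^{0}=\mathrm{id}_X$ and $T_l^{g+h}=T_l^{g}\circ T_l^{h}$ for all $g,h\in G$, and $T_l^{g}\circ T_m^{h}=T_m^{h}\circ T_l^{g}$ for all $g,h\in G$ and $l\neq m$. (The mappings $T_l^g$ may be continuous, but this is not required.) Let $p_{i,l}\colon G^n\to G$, $i=1,\dots,q$, $l=1,\dots,t$, be polynomials in $n$ variables over $G$ with $p_{i,l}(0,\dots,0)=0$. Here a polynomial over $G$ is a map $G^n\to G$ that is obtained from the coordinate functions and the constants of $G$ by finitely many additions, negations and multiplications (so that constants and variables need not commute; for commutative unital $G$ these are the usual polynomial maps). Then for any $\varepsilon>0$ the set of vectors $g=(g_1,\dots,g_n)\in G^n$ for which there exists $x\in X$ such that for every $i=1,\dots,q$ one has $$\rho\Bigl(\prod_{l=1}^{t}T_l^{\,p_{i,l}(g_1,\dots,g_n)}x,\;x\Bigr)<\varepsilon$$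 is an IP$^*$-set in $(G^n,+)$. That is, for every sequence $(u_j)_{j\in\mathbb N}$ in $G^n$ it contains an element of the form $\sum_{j\in\gamma}u_j$ with $\gamma\subset\mathbb N$ finite and nonempty. -/

import Mathlib

/-- The IP-set generated by a sequence `u` in a commutative semigroup: all sums of finitely many
(at least one) terms of `u` with distinct indices. -/
def ipSet {S : Type*} [AddCommMonoid S] (u : ℕ → S) : Set S :=
  {s | ∃ γ : Finset ℕ, γ.Nonempty ∧ s = ∑ j ∈ γ, u j}

/-- An IP*-set: a set that meets every IP-set. -/
def IsIPStar {S : Type*} [AddCommMonoid S] (E : Set S) : Prop :=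
  ∀ u : ℕ → S, (E ∩ ipSet u).Nonempty

/-- `IsPolynomialMap f`: the map `f : G ^ n → G` is given by a polynomial in `n` variables over the
(not necessarily commutative, not necessarily unital) ring `G`, i.e. it is a sum of monomials, each
of them plus or minus a finite product of variables and of constants of `G`, in any order.  This
includes all polynomials in noncommuting variables with coefficients written on the left and, if
`G` is commutative, it gives exactly the usual polynomial maps. -/
inductive IsPolynomialMap {G : Type*} [NonUnitalRing G] {n : ℕ} : ((Fin n → G) → G) → Prop
  | const (c : G) : IsPolynomialMap (fun _ => c)
  | coord (m : Fin n) : IsPolynomialMap (fun g => g m)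
  | add {f₁ f₂ : (Fin n → G) → G} :
      IsPolynomialMap f₁ → IsPolynomialMap f₂ → IsPolynomialMap (fun g => f₁ g + f₂ g)
  | neg {f : (Fin n → G) → G} : IsPolynomialMap f → IsPolynomialMap (fun g => -f g)
  | mul {f₁ f₂ : (Fin n → G) → G} :
      IsPolynomialMap f₁ → IsPolynomialMap f₂ → IsPolynomialMap (fun g => f₁ g * f₂ g)

/-- Given actions `T 0, …, T (t - 1)` of an additive group `G` on `X`, the composition
`T 0 ^ a 0 ∘ ⋯ ∘ T (t - 1) ^ a (t - 1)`, where `a : Fin t → G`. Here an action of `G` is a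
homomorphism from `G`, written multiplicatively, to the monoid of self-maps of `X`. -/
def jointAction {G X : Type*} [AddGroup G] {t : ℕ}
    (T : Fin t → Multiplicative G →* Function.End X) (a : Fin t → G) : Function.End X :=
  (List.ofFn fun l => T l (Multiplicative.ofAdd (a l))).prod

/-!
Polynomial maps have finite degree: some number of successive difference operators kills them, and
this is all that is used about them. Colour `H` by sending `a` to the piece containing `T ^ a x` of
a finite partition of `X` into small sets. If `a` and all `a + p i d` have the same colour, then the
point `T ^ a x` is moved only a little by `T ^ (p i d)`; so one has to find such a configuration,
with `d` in a given IP-set, for every finite colouring.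

This is the IP polynomial van der Waerden theorem, proved by PET induction with colour focusing. Let
`p` have minimal degree in the finite family `A`. Focusing asks for monochromatic configurations of
the maps `f (· + v) - f v - p`, with `f ∈ A` and `v` in a finite set; compared with `A`, they have
as many leading terms in each higher degree, and one fewer in the degree of `p`. Compactness of the
space of colourings keeps the set of shifts `v` finite and independent of the colouring.
-/

open Filter
open scoped fwdDiff

section DegreeLT

variable {V H : Type*} [AddCommMonoid V] [AddCommGroup H]

variable (V H) in
/-- The maps `V → H` of degree less than `d`, that is, those annihilated by any `d` successive
difference operators `Δ_[v]`. As for `Polynomial.degreeLT`, counting from `0` for the zero map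
saves the case distinctions that the degree of a constant would need. -/
def degreeLT : ℕ → AddSubgroup (V → H)
  | 0 => ⊥
  | d + 1 => ⨅ v, (degreeLT d).comap (fwdDiff_aux.fwdDiffₗ V H v).toAddMonoidHom

variable {f : V → H} {d : ℕ}

theorem mem_degreeLT_zero : f ∈ degreeLT V H 0 ↔ f = 0 :=
  AddSubgroup.mem_bot

theorem mem_degreeLT_succ : f ∈ degreeLT V H (d + 1) ↔ ∀ v, Δ_[v] f ∈ degreeLT V H d := by
  simp only [degreeLT, AddSubgroup.mem_iInf, AddSubgroup.mem_comap]
  rfl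

theorem degreeLT_mono : Monotone (degreeLT V H) := by
  refine monotone_nat_of_le_succ fun d => ?_
  induction d with
  | zero => exact bot_le
  | succ d ih => exact fun f hf => mem_degreeLT_succ.2 fun v => ih (mem_degreeLT_succ.1 hf v)

theorem const_mem_degreeLT_succ (c : H) (d : ℕ) : (fun _ => c) ∈ degreeLT V H (d + 1) :=
  mem_degreeLT_succ.2 fun v => by
    rw [fwdDiff_const]
    exact zero_mem _

theorem eq_zero_of_mem_degreeLT_one (hf : f ∈ degreeLT V H 1) (h0 : f 0 = 0) : f = 0 := by
  ext v
  have hv := congrFun (mem_degreeLT_zero.1 (mem_degreeLT_succ.1 hf v)) 0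
  simpa [fwdDiff, h0] using hv

theorem translate_mem_degreeLT (hf : f ∈ degreeLT V H d) (v : V) :
    (fun x => f (x + v)) ∈ degreeLT V H d := by
  have hΔ : Δ_[v] f ∈ degreeLT V H d := mem_degreeLT_succ.1 (degreeLT_mono d.le_succ hf) v
  convert add_mem hf hΔ using 1
  ext x
  simp [fwdDiff]

theorem mul_mem_degreeLT {R : Type*} [NonUnitalNonAssocRing R] {f g : V → R} {a b : ℕ}
    (hf : f ∈ degreeLT V R a) (hg : g ∈ degreeLT V R b) : f * g ∈ degreeLT V R (a + b) := by
  induction a generalizing f g b with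
  | zero =>
    rw [mem_degreeLT_zero.1 hf, zero_mul]
    exact zero_mem _
  | succ a iha =>
    induction b generalizing f g with
    | zero =>
      rw [mem_degreeLT_zero.1 hg, mul_zero]
      exact zero_mem _
    | succ b ihb =>
      refine mem_degreeLT_succ.2 fun v => ?_
      have leibniz : Δ_[v] (f * g) = (fun x => f (x + v)) * Δ_[v] g + Δ_[v] f * g := by
        ext x
        simp [fwdDiff, mul_sub, sub_mul]
      have hleft := ihb (translate_mem_degreeLT hf v) (mem_degreeLT_succ.1 hg v)
      have hright := iha (mem_degreeLT_succ.1 hf v) hg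
      rw [leibniz]
      exact add_mem hleft (degreeLT_mono (by lia) hright)

theorem pi_mem_degreeLT {ι : Type*} {f : V → ι → H} (hf : ∀ i, (f · i) ∈ degreeLT V H d) :
    f ∈ degreeLT V (ι → H) d := by
  induction d generalizing f with
  | zero => exact mem_degreeLT_zero.2 <| funext₂ fun v i =>
      congrFun (mem_degreeLT_zero.1 (hf i)) v
  | succ d ih => exact mem_degreeLT_succ.2 fun v => ih fun i => mem_degreeLT_succ.1 (hf i) v

theorem exists_forall_mem_degreeLT {ι : Type*} [Finite ι] {f : ι → V → H}
    (hf : ∀ i, ∃ d, f i ∈ degreeLT V H d) : ∃ d, ∀ i, f i ∈ degreeLT V H d := by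
  choose d hd using hf
  obtain ⟨D, hD⟩ := (Set.finite_range d).bddAbove
  exact ⟨D, fun i => degreeLT_mono (hD ⟨i, rfl⟩) (hd i)⟩

theorem IsPolynomialMap.exists_mem_degreeLT {G : Type*} [NonUnitalRing G] {n : ℕ}
    {f : (Fin n → G) → G} (hf : IsPolynomialMap f) : ∃ d, f ∈ degreeLT (Fin n → G) G d := by
  induction hf with
  | const c => exact ⟨1, const_mem_degreeLT_succ c 0⟩
  | coord m =>
    refine ⟨2, mem_degreeLT_succ.2 fun v => ?_⟩
    have hΔ : Δ_[v] (fun g : Fin n → G => g m) = fun _ => v m := by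
      ext
      simp [fwdDiff]
    rw [hΔ]
    exact const_mem_degreeLT_succ (v m) 0
  | add _ _ h₁ h₂ =>
    obtain ⟨a, ha⟩ := h₁
    obtain ⟨b, hb⟩ := h₂
    exact ⟨max a b, add_mem (degreeLT_mono (le_max_left a b) ha)
      (degreeLT_mono (le_max_right a b) hb)⟩
  | neg _ h =>
    obtain ⟨a, ha⟩ := h
    exact ⟨a, neg_mem ha⟩
  | mul _ _ h₁ h₂ =>
    obtain ⟨a, ha⟩ := h₁
    obtain ⟨b, hb⟩ := h₂
    exact ⟨a + b, mul_mem_degreeLT ha hb⟩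

end DegreeLT

section Recenter

variable {V H : Type*} [AddCommMonoid V] [AddCommGroup H]

/-- The translate of `f` by `v`, normalized to vanish at `0`. -/
def recenter (v : V) (f : V → H) : V → H := fun x => f (x + v) - f v

variable {f p : V → H} {d : ℕ}

theorem recenter_apply_zero (v : V) (f : V → H) : recenter v f 0 = 0 := by
  simp [recenter]

theorem recenter_mem_degreeLT (hf : f ∈ degreeLT V H d) (v : V) :
    recenter v f ∈ degreeLT V H d := by
  cases d with
  | zero =>
    rw [mem_degreeLT_zero] at hf ⊢
    simp [hf, recenter, funext_iff]
  | succ d => exact sub_mem (translate_mem_degreeLT hf v) (const_mem_degreeLT_succ (f v) d)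

theorem recenter_sub_self_mem_degreeLT (hf : f ∈ degreeLT V H (d + 2)) (v : V) :
    recenter v f - f ∈ degreeLT V H (d + 1) := by
  convert sub_mem (mem_degreeLT_succ.1 hf v) (const_mem_degreeLT_succ (f v) d) using 1
  ext x
  simp only [recenter, fwdDiff, Pi.sub_apply]
  abel

theorem recenter_mem_degreeLT_iff {D : ℕ} (hf : f ∈ degreeLT V H D) {v : V} :
    recenter v f ∈ degreeLT V H (d + 1) ↔ f ∈ degreeLT V H (d + 1) := by
  refine ⟨fun h => ?_, fun h => recenter_mem_degreeLT h v⟩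
  induction D with
  | zero => exact degreeLT_mono (Nat.zero_le _) hf
  | succ D ih =>
    rcases le_or_gt D d with hDd | hdD
    · exact degreeLT_mono (Nat.succ_le_succ hDd) hf
    obtain ⟨D, rfl⟩ := Nat.exists_eq_succ_of_ne_zero (Nat.ne_zero_of_lt hdD)
    refine ih ?_
    rw [← sub_sub_cancel (recenter v f) f]
    exact sub_mem (degreeLT_mono hdD h) (recenter_sub_self_mem_degreeLT hf v)

/-- The family to which a colour focusing step reduces `A`: `p` is subtracted from the recentered
members of `A`, where the shifts `S` are the partial sums that earlier steps have produced. -/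
def derivedFamily (A : Set (V → H)) (S : Set V) (p : V → H) : Set (V → H) :=
  Set.image2 (fun f v => recenter v f - p) A S

end Recenter

section Weight

variable {V H : Type*} [AddCommMonoid V] [AddCommGroup H]

/-- The classes, modulo maps of degree at most `d`, of the members of `A` of degree at most `d + 1`;
the classes other than `0` are the leading terms of the members of degree exactly `d + 1`. -/
def leadingClasses (A : Set (V → H)) (d : ℕ) : Set ((V → H) ⧸ degreeLT V H (d + 1)) :=
  QuotientAddGroup.mk '' (A ∩ degreeLT V H (d + 2))

/-- The number of leading terms of the members of `A` of degree exactly `d + 1`. -/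
noncomputable def weight (A : Set (V → H)) (d : ℕ) : ℕ :=
  (leadingClasses A d \ {0}).ncard

variable {A : Set (V → H)} {S : Set V} {p : V → H} {d D : ℕ}

theorem leadingClasses_finite (hA : A.Finite) (d : ℕ) : (leadingClasses A d).Finite :=
  (hA.inter_of_left _).image _

theorem weight_sdiff_zero (A : Set (V → H)) : weight (A \ {0}) = weight A := by
  ext d
  refine congrArg Set.ncard (Set.Subset.antisymm ?_ ?_)
  · exact Set.sdiff_subset_sdiff_left <|
      Set.image_mono (Set.inter_subset_inter_left _ Set.sdiff_subset)
  · rintro _ ⟨⟨f, ⟨hfA, hfd⟩, rfl⟩, hf0⟩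
    refine ⟨⟨f, ⟨⟨hfA, ?_⟩, hfd⟩, rfl⟩, hf0⟩
    rintro rfl
    exact hf0 rfl

theorem leadingClasses_derivedFamily (hA : A ⊆ degreeLT V H D) (hS : S.Nonempty)
    (hp : p ∈ degreeLT V H (d + 2)) :
    leadingClasses (derivedFamily A S p) d =
      (· - QuotientAddGroup.mk p) '' leadingClasses A d := by
  have hmem : ∀ f ∈ A, ∀ v,
      (recenter v f - p ∈ degreeLT V H (d + 2) ↔ f ∈ degreeLT V H (d + 2)) := fun f hf v => by
    rw [sub_eq_add_neg, add_mem_cancel_right (neg_mem hp), recenter_mem_degreeLT_iff (hA hf)]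
  have hmk : ∀ f ∈ degreeLT V H (d + 2), ∀ v,
      (QuotientAddGroup.mk (recenter v f - p) : (V → H) ⧸ degreeLT V H (d + 1)) =
        QuotientAddGroup.mk f - QuotientAddGroup.mk p := fun f hf v => by
    rw [QuotientAddGroup.mk_sub, sub_left_inj, ← sub_eq_zero, ← QuotientAddGroup.mk_sub,
      QuotientAddGroup.eq_zero_iff]
    exact recenter_sub_self_mem_degreeLT hf v
  ext y
  constructor
  · rintro ⟨_, ⟨⟨f, hf, v, -, rfl⟩, hd⟩, rfl⟩
    have hfd := (hmem f hf v).1 hd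
    exact ⟨_, ⟨f, ⟨hf, hfd⟩, rfl⟩, (hmk f hfd v).symm⟩
  · rintro ⟨_, ⟨f, ⟨hf, hfd⟩, rfl⟩, rfl⟩
    obtain ⟨v, hv⟩ := hS
    exact ⟨_, ⟨⟨f, hf, v, hv, rfl⟩, (hmem f hf v).2 hfd⟩, hmk f hfd v⟩

theorem weight_derivedFamily_eq (hA : A ⊆ degreeLT V H D) (hS : S.Nonempty)
    (hp : p ∈ degreeLT V H (d + 1)) : weight (derivedFamily A S p) d = weight A d := by
  have hp0 : (QuotientAddGroup.mk p : (V → H) ⧸ degreeLT V H (d + 1)) = 0 :=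
    (QuotientAddGroup.eq_zero_iff p).2 hp
  rw [weight, leadingClasses_derivedFamily hA hS (degreeLT_mono (Nat.le_succ _) hp), hp0]
  simp [weight]

theorem weight_derivedFamily_lt (hfin : A.Finite) (hA : A ⊆ degreeLT V H D) (hS : S.Nonempty)
    (hpA : p ∈ A) (hp : p ∈ degreeLT V H (d + 2)) (hmin : ∀ f ∈ A, f ∉ degreeLT V H (d + 1)) :
    weight (derivedFamily A S p) d < weight A d := by
  set P : (V → H) ⧸ degreeLT V H (d + 1) := QuotientAddGroup.mk p
  have hP : P ∈ leadingClasses A d := ⟨p, ⟨hpA, hp⟩, rfl⟩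
  have h0 : 0 ∉ leadingClasses A d := by
    rintro ⟨f, ⟨hf, -⟩, hf0⟩
    exact hmin f hf ((QuotientAddGroup.eq_zero_iff f).1 hf0)
  have hderived : leadingClasses (derivedFamily A S p) d \ {0} =
      (· - P) '' (leadingClasses A d \ {P}) := by
    rw [leadingClasses_derivedFamily hA hS hp, Set.image_sdiff sub_left_injective,
      Set.image_singleton, sub_self]
  rw [weight, hderived, Set.ncard_image_of_injective _ sub_left_injective, weight,
    Set.sdiff_singleton_eq_self h0]
  exact Set.ncard_sdiff_singleton_lt_of_mem hP (leadingClasses_finite hfin d)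

end Weight

section IPSets

variable {V : Type*} [AddCommMonoid V] {u : ℕ → V}

theorem ipSet_shift_subset (u : ℕ → V) (N : ℕ) : ipSet (fun j => u (j + N)) ⊆ ipSet u := by
  rintro _ ⟨γ, hγ, rfl⟩
  exact ⟨γ.map (addRightEmbedding N), hγ.map, by simp [Finset.sum_map]⟩

theorem eventually_add_mem_ipSet {s : V} (hs : s ∈ ipSet u) :
    ∀ᶠ N in atTop, ∀ x ∈ ipSet (fun j => u (j + N)), s + x ∈ ipSet u := by
  classical
  obtain ⟨γ, hγ, rfl⟩ := hs
  filter_upwards [eventually_gt_atTop (γ.sup id)] with N hN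
  rintro _ ⟨δ, -, rfl⟩
  have hdisj : Disjoint γ (δ.map (addRightEmbedding N)) := by
    refine Finset.disjoint_left.2 fun j hjγ hjδ => ?_
    obtain ⟨i, -, rfl⟩ := Finset.mem_map.1 hjδ
    exact (Finset.le_sup (f := id) hjγ |>.trans_lt hN).not_ge (Nat.le_add_left N i)
  refine ⟨γ ∪ δ.map (addRightEmbedding N), hγ.mono Finset.subset_union_left, ?_⟩
  rw [Finset.sum_union hdisj, Finset.sum_map]
  rfl

end IPSets

section Recurrence

variable {V H : Type*} [AddCommMonoid V] [AddCommGroup H]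

/-- `A` is IP-recurrent if for every finite colouring of `H` and every sequence in `V` some
configuration `{a} ∪ {a + f d | f ∈ A}`, with `d` in the IP-set of the sequence, is
monochromatic. -/
def IsIPRecurrent (A : Set (V → H)) : Prop :=
  ∀ (k : ℕ) (u : ℕ → V) (c : H → Fin k), ∃ a, ∃ d ∈ ipSet u, ∀ f ∈ A, c (a + f d) = c a

theorem IsIPRecurrent.exists_of_finite {A : Set (V → H)} (hA : IsIPRecurrent A) {κ : Type*}
    [Finite κ] (u : ℕ → V) (c : H → κ) : ∃ a, ∃ d ∈ ipSet u, ∀ f ∈ A, c (a + f d) = c a := by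
  obtain ⟨k, ⟨e⟩⟩ := Finite.exists_equiv_fin κ
  obtain ⟨a, d, hd, h⟩ := hA k u (e ∘ c)
  exact ⟨a, d, hd, fun f hf => e.injective (h f hf)⟩

theorem isIPRecurrent_empty : IsIPRecurrent (∅ : Set (V → H)) := fun _ u _ =>
  ⟨0, u 0, ⟨{0}, by simp, by simp⟩, by simp⟩

theorem IsIPRecurrent.of_sdiff_zero {A : Set (V → H)} (hA : IsIPRecurrent (A \ {0})) :
    IsIPRecurrent A := by
  intro k u c
  obtain ⟨a, d, hd, h⟩ := hA k u c
  refine ⟨a, d, hd, fun f hf => ?_⟩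
  rcases eq_or_ne f 0 with rfl | hf0
  · simp
  · exact h f ⟨hf, hf0⟩

/-- The state of the colour focusing argument after `r` steps: for `i < j ≤ r`, the vector
`v = d i + ⋯ + d (j - 1)` belongs to the IP-set, and every `a j + f v` with `f ∈ A` has the colour
of `a i`. If `a i` and `a j` have the same colour, this is a monochromatic configuration. -/
def IsFocusingChain {κ : Type*} (A : Set (V → H)) (u : ℕ → V) (c : H → κ) (r : ℕ) (a : ℕ → H)
    (d : ℕ → V) : Prop :=
  ∀ j ∈ Finset.range (r + 1), ∀ i ∈ Finset.range j,
    ∑ l ∈ Finset.Ico i j, d l ∈ ipSet u ∧ ∀ f ∈ A, c (a j + f (∑ l ∈ Finset.Ico i j, d l)) = c (a i)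

variable {A : Set (V → H)} {u : ℕ → V} {r k : ℕ}

theorem isOpen_setOf_isFocusingChain (hA : A.Finite) (u : ℕ → V) (r : ℕ) (a : ℕ → H) (d : ℕ → V) :
    IsOpen {c : H → Fin k | IsFocusingChain A u c r a d} := by
  have heq (x y : H) : IsOpen {c : H → Fin k | c x = c y} :=
    (isOpen_discrete {z : Fin k × Fin k | z.1 = z.2}).preimage
      (f := fun c : H → Fin k => (c x, c y)) (by fun_prop)
  simp only [IsFocusingChain, Set.ofPred_forall, Set.ofPred_and]
  exact isOpen_biInter_finset fun j _ => isOpen_biInter_finset fun i _ =>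
    isOpen_const.inter (hA.isOpen_biInter fun f _ => heq _ _)

theorem exists_finset_isFocusingChain (hA : A.Finite)
    (h : ∀ c : H → Fin k, ∃ a d, IsFocusingChain A u c r a d) :
    ∃ F : Finset ((ℕ → H) × (ℕ → V)), ∀ c : H → Fin k,
      ∃ s ∈ F, IsFocusingChain A u c r s.1 s.2 := by
  obtain ⟨F, hF⟩ := isCompact_univ.elim_finite_subcover
    (fun s : (ℕ → H) × (ℕ → V) => {c : H → Fin k | IsFocusingChain A u c r s.1 s.2})
    (fun s => isOpen_setOf_isFocusingChain hA u r s.1 s.2) fun c _ => by simpa using h c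
  exact ⟨F, fun c => by simpa using hF (Set.mem_univ c)⟩

theorem IsFocusingChain.extend {κ : Type*} {c : H → κ} {a : ℕ → H} {d : ℕ → V} {b e : H} {x : V}
    (h : IsFocusingChain A u (fun y => c (b + y)) r a d) (h0 : ∀ f ∈ A, f 0 = 0)
    (hx : x ∈ ipSet u) (hdx : ∀ i < r, ∑ l ∈ Finset.Ico i r, d l + x ∈ ipSet u)
    (hc : ∀ i ≤ r, ∀ f ∈ A, c (e + f (∑ l ∈ Finset.Ico i r, d l + x)) =
      c (b + (a r + f (∑ l ∈ Finset.Ico i r, d l)))) :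
    IsFocusingChain A u c (r + 1) (Function.update (fun i => b + a i) (r + 1) e)
      (Function.update d r x) := by
  intro j hj i hi
  rw [Finset.mem_range] at hj hi
  have hsum : ∀ j ≤ r, ∑ l ∈ Finset.Ico i j, Function.update d r x l = ∑ l ∈ Finset.Ico i j, d l :=
    fun j hj => Finset.sum_update_of_notMem (by simp [hj]) d x
  rw [Function.update_of_ne (show i ≠ r + 1 by lia)]
  rcases Nat.lt_succ_iff_lt_or_eq.1 hj with hjr | rfl
  · obtain ⟨hd, hcol⟩ := h j (Finset.mem_range.2 hjr) i (Finset.mem_range.2 hi)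
    rw [hsum j (Nat.le_of_lt_succ hjr), Function.update_of_ne hjr.ne]
    exact ⟨hd, fun f hf => by
      rw [add_assoc]
      exact hcol f hf⟩
  · have hir : i ≤ r := Nat.le_of_lt_succ hi
    rw [Finset.sum_Ico_succ_top hir, hsum r le_rfl, Function.update_self, Function.update_self]
    rcases hir.lt_or_eq with hir' | rfl
    · obtain ⟨-, hcol⟩ := h r (Finset.self_mem_range_succ r) i (Finset.mem_range.2 hir')
      exact ⟨hdx i hir', fun f hf => (hc i hir f hf).trans (hcol f hf)⟩
    · refine ⟨by simpa using hx, fun f hf => ?_⟩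
      rw [hc i le_rfl f hf, Finset.Ico_self, Finset.sum_empty, h0 f hf, add_zero]

theorem IsIPRecurrent.exists_focus {S : Set V} {E : Set H} {p : V → H}
    (h : IsIPRecurrent (derivedFamily A S p)) (hA : A.Finite) (hS : S.Finite) (hE : E.Finite)
    (u : ℕ → V) (c : H → Fin k) :
    ∃ b, ∃ x ∈ ipSet u, (∀ v ∈ S, v ∈ ipSet u → v + x ∈ ipSet u) ∧
      ∀ f ∈ A, ∀ v ∈ S, ∀ y ∈ E, c (b + y - p x + f (v + x)) = c (b + (y + f v)) := by
  obtain ⟨N, hN⟩ : ∃ N, ∀ v ∈ S, v ∈ ipSet u → ∀ x ∈ ipSet (fun j => u (j + N)),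
      v + x ∈ ipSet u :=
    ((eventually_all_finite (l := atTop) hS).2 fun v _ =>
      eventually_imp_distrib_left.2 eventually_add_mem_ipSet).exists
  set K : Set H := Set.image2 (· + ·) E (Set.image2 (fun f v => f v) A S)
  have hK : K.Finite := hE.image2 _ (hA.image2 _ hS)
  have : Finite K := hK
  obtain ⟨b, x, hx, hb⟩ := h.exists_of_finite (fun j => u (j + N)) fun y (z : K) => c (y + z)
  refine ⟨b, x, ipSet_shift_subset u N hx, fun v hv hvu => hN v hv hvu x hx,
    fun f hf v hv y hy => ?_⟩
  have hz : y + f v ∈ K := ⟨y, hy, _, ⟨f, hf, v, hv, rfl⟩, rfl⟩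
  have hcol : c (b + (recenter v f - p) x + (y + f v)) = c (b + (y + f v)) :=
    congrFun (hb _ ⟨f, hf, v, hv, rfl⟩) ⟨y + f v, hz⟩
  rw [← hcol]
  congr 1
  simp only [recenter, Pi.sub_apply, add_comm x v]
  abel

theorem exists_isFocusingChain (hA : A.Finite) (h0 : ∀ f ∈ A, f 0 = 0) (p : V → H)
    (h : ∀ S : Set V, S.Finite → S.Nonempty → IsIPRecurrent (derivedFamily A S p))
    (u : ℕ → V) (r : ℕ) (c : H → Fin k) : ∃ a d, IsFocusingChain A u c r a d := by
  induction r generalizing c with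
  | zero =>
    refine ⟨0, 0, fun j hj i hi => ?_⟩
    simp [Nat.lt_one_iff.1 (Finset.mem_range.1 hj)] at hi
  | succ r ih =>
    -- By compactness finitely many chains `F` serve all colourings, in particular all translates
    -- `c (b + ·)`, so that `S` and `E` can be chosen before `b` is known.
    obtain ⟨F, hF⟩ := exists_finset_isFocusingChain hA ih
    set S : Set V := Set.image2 (fun (s : (ℕ → H) × (ℕ → V)) i => ∑ l ∈ Finset.Ico i r, s.2 l)
      F (Set.Iic r)
    have hS : S.Finite := F.finite_toSet.image2 _ (Set.finite_Iic r)
    have hmemS : ∀ s ∈ F, ∀ i ≤ r, ∑ l ∈ Finset.Ico i r, s.2 l ∈ S := fun s hs i hi =>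
      ⟨s, hs, i, hi, rfl⟩
    have hSne : S.Nonempty := by
      obtain ⟨s, hs, -⟩ := hF c
      exact ⟨_, hmemS s hs r le_rfl⟩
    set E : Set H := (fun s : (ℕ → H) × (ℕ → V) => s.1 r) '' F
    have hE : E.Finite := F.finite_toSet.image _
    obtain ⟨b, x, hx, hadd, hfocus⟩ := (h S hS hSne).exists_focus hA hS hE u c
    obtain ⟨⟨a, d⟩, hs, hchain⟩ := hF fun y => c (b + y)
    refine ⟨_, _, hchain.extend (e := b + a r - p x) h0 hx (fun i hi => ?_)
      fun i hi f hf => hfocus f hf _ (hmemS _ hs i hi) _ ⟨_, hs, rfl⟩⟩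
    exact hadd _ (hmemS _ hs i hi.le)
      (hchain r (Finset.self_mem_range_succ r) i (Finset.mem_range.2 hi)).1

theorem IsIPRecurrent.of_derivedFamily (hA : A.Finite) (h0 : ∀ f ∈ A, f 0 = 0) (p : V → H)
    (h : ∀ S : Set V, S.Finite → S.Nonempty → IsIPRecurrent (derivedFamily A S p)) :
    IsIPRecurrent A := by
  intro k u c
  obtain ⟨a, d, hchain⟩ := exists_isFocusingChain hA h0 p h u k c
  obtain ⟨i, hi, j, hj, hij, hcol⟩ : ∃ i ∈ Finset.range (k + 1), ∃ j ∈ Finset.range (k + 1),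
      i ≠ j ∧ c (a i) = c (a j) :=
    Finset.exists_ne_map_eq_of_card_lt_of_maps_to (t := Finset.univ) (by simp) (by simp)
  wlog hlt : i < j generalizing i j
  · exact this j hj i hi hij.symm hcol.symm (hij.lt_or_gt.resolve_left hlt)
  obtain ⟨hd, hf⟩ := hchain j hj i (Finset.mem_range.2 hlt)
  exact ⟨a j, _, hd, fun f hfA => (hf f hfA).trans hcol⟩

theorem exists_minimal_degree {D : ℕ} (hA : A ⊆ degreeLT V H D) (h0 : ∀ f ∈ A, f 0 = 0)
    (hne : (A \ {0}).Nonempty) :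
    ∃ d < D, (∃ p ∈ A \ {0}, p ∈ degreeLT V H (d + 2)) ∧
      ∀ f ∈ A \ {0}, f ∉ degreeLT V H (d + 1) := by
  obtain ⟨g, hg⟩ := hne
  have hone : ¬ ∃ f ∈ A \ {0}, f ∈ degreeLT V H (0 + 1) := fun ⟨f, hf, hf1⟩ =>
    hf.2 (eq_zero_of_mem_degreeLT_one hf1 (h0 f hf.1))
  obtain ⟨d, hd, hd'⟩ := Nat.exists_not_and_succ_of_not_zero_of_exists
    (p := fun d => ∃ f ∈ A \ {0}, f ∈ degreeLT V H (d + 1)) hone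
      ⟨D, g, hg, degreeLT_mono D.le_succ (hA hg.1)⟩
  have hmin : ∀ f ∈ A \ {0}, f ∉ degreeLT V H (d + 1) := fun f hf hfd => hd ⟨f, hf, hfd⟩
  refine ⟨d, ?_, hd', hmin⟩
  by_contra! hD
  exact hmin g hg (degreeLT_mono (hD.trans d.le_succ) (hA hg.1))

/-- The IP polynomial van der Waerden theorem of Bergelson and Leibman. -/
theorem isIPRecurrent_of_subset_degreeLT {D : ℕ} (hfin : A.Finite) (hA : A ⊆ degreeLT V H D)
    (h0 : ∀ f ∈ A, f 0 = 0) : IsIPRecurrent A := by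
  -- PET induction: weights are compared lexicographically, starting from the highest degree.
  have wf : WellFounded (Pi.Lex (· > · : Fin D → Fin D → Prop)
      (fun {_} => (· < · : ℕ → ℕ → Prop))) :=
    Pi.Lex.wellFounded _ fun _ => wellFounded_lt
  induction hw : (fun d : Fin D => weight A d) using wf.induction generalizing A with
  | _ w ih =>
    subst hw
    apply IsIPRecurrent.of_sdiff_zero
    rcases (A \ {0}).eq_empty_or_nonempty with hempty | hne
    · rw [hempty]
      exact isIPRecurrent_empty
    obtain ⟨d, hdD, ⟨p, hpA, hp⟩, hmin⟩ := exists_minimal_degree hA h0 hne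
    have hfin' : (A \ {0}).Finite := hfin.subset Set.sdiff_subset
    have hA' : A \ {0} ⊆ degreeLT V H D := Set.sdiff_subset.trans hA
    refine .of_derivedFamily hfin' (fun f hf => h0 f hf.1) p fun S hS hSne => ?_
    refine ih _ ⟨⟨d, hdD⟩, fun e he => ?_, ?_⟩ (hfin'.image2 _ hS) ?_ ?_ rfl
    · dsimp only
      rw [← weight_sdiff_zero A]
      exact weight_derivedFamily_eq hA' hSne (degreeLT_mono (Nat.succ_le_succ he) hp)
    · dsimp only
      rw [← weight_sdiff_zero A]
      exact weight_derivedFamily_lt hfin' hA' hSne hpA hp hmin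
    · rintro _ ⟨f, hf, v, -, rfl⟩
      exact sub_mem (recenter_mem_degreeLT (hA' hf) v) (hA' hpA)
    · rintro _ ⟨f, -, v, -, rfl⟩
      simp only [Pi.sub_apply, recenter_apply_zero, h0 p hpA.1, sub_zero]

end Recurrence

section Action

theorem exists_coloring_dist_lt {X : Type*} [PseudoMetricSpace X]
    (hX : TotallyBounded (Set.univ : Set X)) {ε : ℝ} (hε : 0 < ε) :
    ∃ (k : ℕ) (c : X → Fin k), ∀ x y, c x = c y → dist x y < ε := by
  obtain ⟨s, hs, hcover⟩ := Metric.totallyBounded_iff.1 hX (ε / 2) (half_pos hε)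
  have hnear : ∀ x : X, ∃ y : s, dist x y < ε / 2 := fun x => by
    obtain ⟨y, hy, hxy⟩ := Set.mem_iUnion₂.1 (hcover (Set.mem_univ x))
    exact ⟨⟨y, hy⟩, hxy⟩
  choose center hcenter using hnear
  have : Finite s := hs
  obtain ⟨k, ⟨e⟩⟩ := Finite.exists_equiv_fin s
  refine ⟨k, e ∘ center, fun x y hxy => ?_⟩
  have hxy' : center x = center y := e.injective hxy
  calc dist x y ≤ dist x (center x) + dist y (center x) := dist_triangle_right _ _ _
    _ < ε / 2 + ε / 2 := add_lt_add (hcenter x) (hxy' ▸ hcenter y)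
    _ = ε := add_halves ε

theorem IsIPRecurrent.isIPStar {V H X : Type*} [AddCommMonoid V] [AddCommGroup H]
    [PseudoMetricSpace X] [Nonempty X] {A : Set (V → H)} (hA : IsIPRecurrent A)
    (hX : TotallyBounded (Set.univ : Set X)) {τ : H → X → X}
    (hτ : ∀ a b x, τ (a + b) x = τ a (τ b x)) {ε : ℝ} (hε : 0 < ε) :
    IsIPStar {v : V | ∃ x : X, ∀ f ∈ A, dist (τ (f v) x) x < ε} := by
  intro u
  obtain ⟨k, c, hc⟩ := exists_coloring_dist_lt hX hε
  obtain ⟨x⟩ := ‹Nonempty X›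
  obtain ⟨a, d, hd, hrec⟩ := hA k u fun h => c (τ h x)
  refine ⟨d, ⟨τ a x, fun f hf => hc _ _ ?_⟩, hd⟩
  rw [← hτ, add_comm]
  exact hrec f hf

theorem jointAction_add {G X : Type*} [AddGroup G] {t : ℕ}
    (T : Fin t → Multiplicative G →* Function.End X)
    (hT : ∀ l m : Fin t, l ≠ m → ∀ (a b : Multiplicative G) (x : X),
      T l a (T m b x) = T m b (T l a x))
    (a b : Fin t → G) : jointAction T (a + b) = jointAction T a * jointAction T b := by
  have hcomm : Pairwise fun l m => ∀ a b, Commute (T l a) (T m b) := fun l m hlm a b =>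
    funext (hT l m hlm a b)
  have hprod : ∀ a : Fin t → G, jointAction T a =
      MonoidHom.noncommPiCoprod T hcomm fun l => Multiplicative.ofAdd (a l) := fun a => by
    rw [jointAction, List.ofFn_eq_map, MonoidHom.noncommPiCoprod_apply]
    exact (Multiset.noncommProd_coe _ (Finset.noncommProd_lemma Finset.univ
      (fun l => T l (Multiplicative.ofAdd (a l))) fun l _ m _ h => hcomm h _ _)).symm
  rw [hprod, hprod, hprod, ← map_mul]
  rfl

theorem corollary7p15_general {V H X ι : Type*} [AddCommMonoid V] [AddCommGroup H]
    [PseudoMetricSpace X] [Nonempty X] [Finite ι] (hX : TotallyBounded (Set.univ : Set X)) {t : ℕ}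
    (T : Fin t → Multiplicative H →* Function.End X)
    (hT : ∀ l m : Fin t, l ≠ m → ∀ (a b : Multiplicative H) (x : X),
      T l a (T m b x) = T m b (T l a x))
    (p : ι → Fin t → V → H) (hp : ∀ i l, ∃ d, p i l ∈ degreeLT V H d) (hp0 : ∀ i l, p i l 0 = 0)
    {ε : ℝ} (hε : 0 < ε) :
    IsIPStar {v : V | ∃ x : X, ∀ i, dist (jointAction T (fun l => p i l v) x) x < ε} := by
  let P (i : ι) (v : V) (l : Fin t) : H := p i l v
  have hP : ∀ i, ∃ d, P i ∈ degreeLT V (Fin t → H) d := fun i => by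
    obtain ⟨d, hd⟩ := exists_forall_mem_degreeLT (hp i)
    exact ⟨d, pi_mem_degreeLT hd⟩
  obtain ⟨D, hD⟩ := exists_forall_mem_degreeLT hP
  have hrec : IsIPRecurrent (Set.range P) :=
    isIPRecurrent_of_subset_degreeLT (Set.finite_range P) (Set.range_subset_iff.2 hD)
      (Set.forall_mem_range.2 fun i => funext (hp0 i))
  simpa only [Set.forall_mem_range] using
    hrec.isIPStar hX (fun a b x => congrFun (jointAction_add T hT a b) x) hε

end Action

theorem corollary7p15 {G X : Type*} [NonUnitalRing G] [MetricSpace X] [Nonempty X]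
    (hX : TotallyBounded (Set.univ : Set X)) (t q n : ℕ)
    (T : Fin t → Multiplicative G →* Function.End X)
    (hT : ∀ l m : Fin t, l ≠ m → ∀ (a b : Multiplicative G) (x : X),
      T l a (T m b x) = T m b (T l a x))
    (p : Fin q → Fin t → (Fin n → G) → G)
    (hp : ∀ i l, IsPolynomialMap (p i l)) (hp0 : ∀ i l, p i l 0 = 0)
    (ε : ℝ) (hε : 0 < ε) :
    IsIPStar {g : Fin n → G |
      ∃ x : X, ∀ i : Fin q, dist (jointAction T (fun l => p i l g) x) x < ε} :=
  corollary7p15_general hX T hT p (fun i l => (hp i l).exists_mem_degreeLT) hp0 hε
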